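/- Let $G$ be an abelian group, written additively. A triple $x,y,z\in G$ is a distinct Schur triple if $x+y=z$ and $x,y,z$ are pairwise distinct. A subset of $G$ is distinct sum-free if it contains no distinct Schur triple, and it is a maximal distinct sum-free subset of $G$ if moreover it is not properly contained in another distinct sum-free subset of $G$. For a finite abelian group $G$, let $f^\star_{\max}(G)$ denote the number of maximal distinct sum-free subsets of $G$. Theorem (Sharp lower bound for even order abelian groups). There exists an absolute constant $C\in\{1,2,3,\dots\}$ such that the following holds. Given any real $\eta>0$, there exists a positive integer $n_0$ such that the following holds for all even $n\ge n_0$. Let $G$ be an abelian group of order $n$ with $$G\cong\mathbb{Z}_{2^{\alpha_1}}\oplus\cdots\oplus\mathbb{Z}_{2^{\alpha_{r_1}}}\oplus\mathbb{Z}_2^{r_2}\oplus K,$$ where $r_1,r_2\ge 0$ are integers, $\alpha_1\ge\cdots\ge\alpha_{r_1}\ge 2$ are integers, and $K$ is a finite abelian group of odd order. Set $r:=r_1+r_2$ and suppose $r\ge 1$. If $n/2^r\ge C$, then $$f^\star_{\max}(G)\ \ge\ \left(2^{2r-1}+2^{r+r_1-1}-2^{r+1}+2^{r_1}\right)2^{n/4}+\left(2^r-2^{r_1}-\eta\right)2^{n/4-2^{r-2}}.$$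 -/

import Mathlib

universe u v

/-- `(x, y, z)` is a *distinct Schur triple*: `x + y = z` with `x`, `y`, `z` pairwise distinct. -/
def IsDistinctSchurTriple {G : Type*} [Add G] (x y z : G) : Prop :=
  x + y = z ∧ x ≠ y ∧ x ≠ z ∧ y ≠ z

/-- A set is *distinct sum-free* if it contains no distinct Schur triple. -/
def IsDistinctSumFree {G : Type*} [Add G] (S : Set G) : Prop :=
  ∀ x ∈ S, ∀ y ∈ S, ∀ z ∈ S, ¬ IsDistinctSchurTriple x y z

/-- A *maximal distinct sum-free* set: distinct sum-free, and not properly contained in another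
distinct sum-free subset of `G`. -/
def IsMaximalDistinctSumFree {G : Type*} [Add G] (S : Set G) : Prop :=
  IsDistinctSumFree S ∧ ∀ T : Set G, IsDistinctSumFree T → ¬ S ⊂ T

/-- The number `f⋆_max(G)` of maximal distinct sum-free subsets of `G` (for finite `G`). -/
noncomputable def fStarMax (G : Type*) [Add G] : ℕ :=
  Set.ncard {S : Set G | IsMaximalDistinctSumFree S}

/-!
The maximal distinct sum-free sets counted here consist of `0`, an element `s` with `2s = 0`
(possibly `s = 0`), and one element from each set `{±x, ±x + s}`, `x` running over a nontrivial
coset of an index-2 subgroup `ker χ` containing `s`. In the coset, two elements form a distinct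
Schur triple with `0` or `s` exactly when they are distinct and lie in the same set `{±x, ±x + s}`,
so transversals are the maximal choices in the coset that are compatible with `{0, s}`.

*Number of transversals.* The sets `{±x, ±x + s}` partition the coset, which has `n / 2` elements.
If `s ≠ 0` they have size `k = 2` or `4`, and `k ^ 2 = 2 ^ k` in both cases, so there are exactly
`2 ^ (n / 4)` transversals (`card_transversals_of_ne_zero`). If `s = 0` the elements killed by `2`
form orbits of size `1`; there are none in the coset when `χ` vanishes on the 2-torsion, and
`2 ^ (r - 1)` otherwise, which gives `2 ^ (n / 4)` and `2 ^ (n / 4 - 2 ^ (r - 2))` transversals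
respectively (`card_transversals_zero`). Of the `2 ^ r - 1` nonzero homomorphisms `χ`, exactly
`2 ^ r₁ - 1` vanish on the 2-torsion; summing over all pairs `(χ, s)` gives the stated coefficients.

*Maximality and distinctness.* An element `q` of `ker χ` other than `0` and `s` cannot be added if
`q` is a difference of two members of the transversal. For a fixed `q`, translation by `q` joins
at least `n / 64` disjoint pairs of orbits, and a transversal avoids the difference `q` on each pair
with proportion at most `15 / 16`, independently (`exists_card_avoid_le`). Hence all but an
exponentially small proportion of the transversals are spread (`IsSpread`), and these yield maximal
sets (`isMaximalDistinctSumFree_transversalSet`). Spreadness also makes `χ` and `s` recoverable from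
the set (`eq_and_eq_of_transversalSet_eq`), so nothing is counted twice. As `2 ^ (r - 2)` is a small
multiple of `n` when `n / 2 ^ r` is large, the loss is below `η * 2 ^ (n / 4 - 2 ^ (r - 2))`.
-/

/-! ### Orbits and their transversals -/

section Orbits

variable {G : Type*} [AddCommGroup G] [DecidableEq G]

/-- The set `{±x, ±x + s}`. When `s + s = 0` it is the orbit of `x` under the group generated by
`y ↦ -y` and `y ↦ y + s`. -/
def signOrbit (s x : G) : Finset G := {x, -x, x + s, -x + s}

theorem mem_signOrbit {s x y : G} :
    y ∈ signOrbit s x ↔ y = x ∨ y = -x ∨ y = x + s ∨ y = -x + s := by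
  simp [signOrbit]

theorem self_mem_signOrbit (s x : G) : x ∈ signOrbit s x := by simp [signOrbit]

omit [DecidableEq G] in
theorem neg_eq_self_of_add_self {s : G} (hs : s + s = 0) : -s = s :=
  neg_eq_of_add_eq_zero_left hs

theorem signOrbit_eq_of_mem {s x y : G} (hs : s + s = 0) (h : y ∈ signOrbit s x) :
    signOrbit s y = signOrbit s x := by
  have hn := neg_eq_self_of_add_self hs
  ext z
  rw [mem_signOrbit] at h
  simp only [mem_signOrbit]
  rcases h with rfl | rfl | rfl | rfl
  · rfl
  · simp only [neg_neg]; tauto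
  · simp only [neg_add, hn, add_assoc, hs, add_zero]; tauto
  · simp only [neg_add, hn, add_assoc, hs, add_zero, neg_neg]; tauto

theorem card_signOrbit_le (s x : G) : (signOrbit s x).card ≤ 4 := Finset.card_le_four

/-- If `s ≠ 0`, a sign orbit has `2` or `4` elements, and those are the solutions of
`k ^ 2 = 2 ^ k`. -/
theorem card_signOrbit_sq {s : G} (hs : s + s = 0) (h0 : s ≠ 0) (x : G) :
    (signOrbit s x).card ^ 2 = 2 ^ (signOrbit s x).card := by
  have hn := neg_eq_self_of_add_self hs
  by_cases h1 : x = -x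
  · have : signOrbit s x = {x, x + s} := by
      ext z; simp only [mem_signOrbit, ← h1, Finset.mem_insert, Finset.mem_singleton]; tauto
    rw [this, Finset.card_pair (by simpa using h0)]
  · by_cases h2 : x = -x + s
    · have h3 : -x = x + s := by
        conv_rhs => rw [h2]
        rw [add_assoc, hs, add_zero]
      have : signOrbit s x = {x, -x} := by
        ext z; simp only [mem_signOrbit, ← h2, ← h3, Finset.mem_insert, Finset.mem_singleton]; tauto
      rw [this, Finset.card_pair h1]
    · have : (signOrbit s x).card = 4 := by
        rw [signOrbit, Finset.card_insert_of_notMem, Finset.card_insert_of_notMem,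
          Finset.card_pair]
        · simpa using h1
        · simp only [Finset.mem_insert, Finset.mem_singleton, not_or]
          refine ⟨fun h => h2 ?_, by simpa using h0⟩
          rw [h, add_assoc, hs, add_zero]
        · simp only [Finset.mem_insert, Finset.mem_singleton, not_or]
          exact ⟨h1, by simpa using h0, h2⟩
      rw [this]
      norm_num

theorem signOrbit_zero (x : G) : signOrbit 0 x = {x, -x} := by
  ext z; simp only [mem_signOrbit, add_zero, Finset.mem_insert, Finset.mem_singleton]; tauto

variable [Fintype G]

/-- The nontrivial coset of the kernel of `χ`. -/
def oddCoset (χ : G →+ ZMod 2) : Finset G := Finset.univ.filter fun x => χ x = 1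

omit [DecidableEq G] in
@[simp] theorem mem_oddCoset {χ : G →+ ZMod 2} {x : G} : x ∈ oddCoset χ ↔ χ x = 1 := by
  simp [oddCoset]

/-- The sign orbits in the nontrivial coset of the kernel of `χ`. -/
def oddOrbits (χ : G →+ ZMod 2) (s : G) : Finset (Finset G) := (oddCoset χ).image (signOrbit s)

omit [Fintype G] in
theorem map_eq_of_mem_signOrbit {χ : G →+ ZMod 2} {s x y : G} (hχ : χ s = 0)
    (h : y ∈ signOrbit s x) : χ y = χ x := by
  rw [mem_signOrbit] at h
  rcases h with rfl | rfl | rfl | rfl <;> simp [hχ, ZMod.neg_eq_self_mod_two]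

/-- The orbit of an element of the nontrivial coset. -/
def orbitOf (χ : G →+ ZMod 2) (s : G) (x : {x : G // χ x = 1}) : {o // o ∈ oddOrbits χ s} :=
  ⟨signOrbit s x.1, Finset.mem_image_of_mem _ (mem_oddCoset.2 x.2)⟩

/-- The transversals of the orbits in the nontrivial coset of the kernel of `χ`, encoded as choice
functions. -/
def transversals (χ : G →+ ZMod 2) (s : G) : Finset ({o // o ∈ oddOrbits χ s} → G) :=
  Fintype.piFinset fun o => o.1

variable {χ : G →+ ZMod 2} {s : G} {f : {o // o ∈ oddOrbits χ s} → G}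

theorem mem_transversals : f ∈ transversals χ s ↔ ∀ o, f o ∈ o.1 := by
  simp [transversals]

theorem odd_of_mem_oddOrbits (hχ : χ s = 0) {o : Finset G} (ho : o ∈ oddOrbits χ s) {x : G}
    (hx : x ∈ o) : χ x = 1 := by
  obtain ⟨y, hy, rfl⟩ := Finset.mem_image.1 ho
  rw [map_eq_of_mem_signOrbit hχ hx, mem_oddCoset.1 hy]

theorem eq_signOrbit_of_mem (hs : s + s = 0) {o : Finset G} (ho : o ∈ oddOrbits χ s) {x : G}
    (hx : x ∈ o) : o = signOrbit s x := by
  obtain ⟨y, hy, rfl⟩ := Finset.mem_image.1 ho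
  exact (signOrbit_eq_of_mem hs hx).symm

/-- Sums over the odd coset may be taken orbit by orbit. -/
theorem sum_card_filter_oddOrbits (hs : s + s = 0) (hχ : χ s = 0) (p : G → Prop)
    [DecidablePred p] :
    ∑ o ∈ oddOrbits χ s, (o.filter p).card = ((oddCoset χ).filter p).card := by
  rw [Finset.card_eq_sum_card_fiberwise (f := signOrbit s) (t := oddOrbits χ s)]
  · refine Finset.sum_congr rfl fun o ho => congrArg _ ?_
    ext x
    simp only [Finset.mem_filter, mem_oddCoset]
    constructor
    · rintro ⟨hx, hp⟩
      exact ⟨⟨odd_of_mem_oddOrbits hχ ho hx, hp⟩, (eq_signOrbit_of_mem hs ho hx).symm⟩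
    · rintro ⟨⟨-, hp⟩, rfl⟩
      exact ⟨self_mem_signOrbit s x, hp⟩
  · intro x hx
    exact Finset.mem_image_of_mem _ (Finset.mem_filter.1 hx).1

theorem sum_card_oddOrbits (hs : s + s = 0) (hχ : χ s = 0) :
    ∑ o ∈ oddOrbits χ s, o.card = (oddCoset χ).card := by
  simpa using sum_card_filter_oddOrbits hs hχ (fun _ => True)

theorem card_transversals (χ : G →+ ZMod 2) (s : G) :
    (transversals χ s).card = ∏ o ∈ oddOrbits χ s, o.card := by
  rw [transversals, Fintype.card_piFinset]
  exact Finset.prod_attach (oddOrbits χ s) fun o => o.card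

theorem card_transversals_sq (hs : s + s = 0) (hχ : χ s = 0) (h0 : s ≠ 0) :
    (transversals χ s).card ^ 2 = 2 ^ (oddCoset χ).card := by
  rw [card_transversals, ← Finset.prod_pow, ← sum_card_oddOrbits hs hχ, ← Finset.prod_pow_eq_pow_sum]
  refine Finset.prod_congr rfl fun o ho => ?_
  obtain ⟨x, -, rfl⟩ := Finset.mem_image.1 ho
  exact card_signOrbit_sq hs h0 x

theorem card_transversals_zero_sq (χ : G →+ ZMod 2) :
    (transversals χ 0).card ^ 2 * 2 ^ ((oddCoset χ).filter fun x => x + x = 0).card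
      = 2 ^ (oddCoset χ).card := by
  have hs : (0 : G) + 0 = 0 := add_zero 0
  have hχ : χ 0 = 0 := map_zero χ
  rw [card_transversals, ← Finset.prod_pow, ← sum_card_oddOrbits hs hχ,
    ← sum_card_filter_oddOrbits hs hχ, ← Finset.prod_pow_eq_pow_sum,
    ← Finset.prod_pow_eq_pow_sum, ← Finset.prod_mul_distrib]
  refine Finset.prod_congr rfl fun o ho => ?_
  obtain ⟨x, -, rfl⟩ := Finset.mem_image.1 ho
  rw [signOrbit_zero]
  by_cases h : x + x = 0
  · have : -x = x := neg_eq_self_of_add_self h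
    simp [this, h, Finset.filter_singleton]
  · have h1 : x ≠ -x := fun h' => h (by nth_rw 2 [h']; simp)
    have h2 : -x + -x ≠ 0 := fun h' => h (by rw [← neg_add, neg_eq_zero] at h'; exact h')
    simp only [Finset.card_pair h1, Finset.filter_insert, Finset.filter_singleton, h, h2, if_false,
      Finset.card_empty, pow_zero, mul_one]

end Orbits

/-! ### Maximal distinct sum-free sets from transversals -/

section Construction

variable {G : Type*} [AddCommGroup G] [DecidableEq G] [Fintype G]

/-- A transversal is *spread* if every element of the kernel of `χ` other than `0` and `s` is a
difference of two of its members that are not killed by `2`. The last requirement makes `χ`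
recoverable from the set `transversalSet χ s f`. -/
def IsSpread (χ : G →+ ZMod 2) (s : G) (f : {o // o ∈ oddOrbits χ s} → G) : Prop :=
  ∀ q, χ q = 0 → q ≠ 0 → q ≠ s →
    ∃ x ∈ Set.range f, x + q ∈ Set.range f ∧ x + x ≠ 0 ∧ (x + q) + (x + q) ≠ 0

/-- The members of the transversal `f`, together with `0` and `s`. -/
def transversalSet (χ : G →+ ZMod 2) (s : G) (f : {o // o ∈ oddOrbits χ s} → G) : Set G :=
  Set.range f ∪ {0, s}

variable {χ : G →+ ZMod 2} {s : G} {f : {o // o ∈ oddOrbits χ s} → G}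

theorem odd_of_mem_range (hχ : χ s = 0) (hf : f ∈ transversals χ s) {x : G}
    (hx : x ∈ Set.range f) : χ x = 1 := by
  obtain ⟨o, rfl⟩ := hx
  exact odd_of_mem_oddOrbits hχ o.2 (mem_transversals.1 hf o)

theorem eq_of_mem_range_of_mem_signOrbit (hs : s + s = 0) (hf : f ∈ transversals χ s) {x y : G}
    (hx : x ∈ Set.range f) (hy : y ∈ Set.range f) (h : y ∈ signOrbit s x) : y = x := by
  obtain ⟨o, rfl⟩ := hx
  obtain ⟨p, rfl⟩ := hy
  have h1 := eq_signOrbit_of_mem hs o.2 (mem_transversals.1 hf o)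
  have h2 := eq_signOrbit_of_mem hs p.2 (mem_transversals.1 hf p)
  congr 1
  exact Subtype.ext (by rw [h1, h2, signOrbit_eq_of_mem hs h])

theorem exists_mem_range_mem_signOrbit (hf : f ∈ transversals χ s) {x : G} (hx : χ x = 1) :
    ∃ y ∈ Set.range f, y ∈ signOrbit s x :=
  ⟨_, ⟨orbitOf χ s ⟨x, hx⟩, rfl⟩, mem_transversals.1 hf (orbitOf χ s ⟨x, hx⟩)⟩

theorem mem_range_iff_of_odd (hχ : χ s = 0) {x : G} (hx : χ x = 1) :
    x ∈ transversalSet χ s f ↔ x ∈ Set.range f := by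
  simp only [transversalSet, Set.mem_union, Set.mem_insert_iff, Set.mem_singleton_iff,
    or_iff_left_iff_imp]
  rintro (rfl | rfl)
  · simp at hx
  · simp [hχ] at hx

theorem mem_pair_iff_of_even (hχ : χ s = 0) (hf : f ∈ transversals χ s) {x : G} (hx : χ x = 0) :
    x ∈ transversalSet χ s f ↔ x = 0 ∨ x = s := by
  simp only [transversalSet, Set.mem_union, Set.mem_insert_iff, Set.mem_singleton_iff,
    or_iff_right_iff_imp]
  intro h
  have := odd_of_mem_range hχ hf h
  simp [hx] at this

theorem isDistinctSumFree_transversalSet (hs : s + s = 0) (hχ : χ s = 0)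
    (hf : f ∈ transversals χ s) : IsDistinctSumFree (transversalSet χ s f) := by
  rintro x hx y hy z hz ⟨rfl, hxy, hxz, hyz⟩
  have hn := neg_eq_self_of_add_self hs
  have two : ∀ a : ZMod 2, a = 0 ∨ a = 1 := by decide
  rcases two (χ x) with h1 | h1 <;> rcases two (χ y) with h2 | h2
  · rw [mem_pair_iff_of_even hχ hf h1] at hx
    rw [mem_pair_iff_of_even hχ hf h2] at hy
    rcases hx with rfl | rfl <;> rcases hy with rfl | rfl <;> simp_all
  · have h3 : χ (x + y) = 1 := by simp [h1, h2]
    rw [mem_pair_iff_of_even hχ hf h1] at hx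
    rw [mem_range_iff_of_odd hχ h2] at hy
    rw [mem_range_iff_of_odd hχ h3] at hz
    refine hyz (eq_of_mem_range_of_mem_signOrbit hs hf hy hz ?_).symm
    rw [mem_signOrbit]
    rcases hx with rfl | rfl
    · simp
    · simp [add_comm]
  · have h3 : χ (x + y) = 1 := by simp [h1, h2]
    rw [mem_pair_iff_of_even hχ hf h2] at hy
    rw [mem_range_iff_of_odd hχ h1] at hx
    rw [mem_range_iff_of_odd hχ h3] at hz
    refine hxz (eq_of_mem_range_of_mem_signOrbit hs hf hx hz ?_).symm
    rw [mem_signOrbit]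
    rcases hy with rfl | rfl <;> simp
  · have h3 : χ (x + y) = 0 := by rw [map_add, h1, h2]; decide
    rw [mem_range_iff_of_odd hχ h1] at hx
    rw [mem_range_iff_of_odd hχ h2] at hy
    rw [mem_pair_iff_of_even hχ hf h3] at hz
    refine hxy (eq_of_mem_range_of_mem_signOrbit hs hf hx hy ?_).symm
    rw [mem_signOrbit]
    rcases hz with hz | hz
    · exact Or.inr (Or.inl (eq_neg_of_add_eq_zero_right hz))
    · exact Or.inr (Or.inr (Or.inr (by rw [← hz]; abel)))

/-- Every element outside `transversalSet χ s f` is excluded: an odd one forms a distinct Schur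
triple with `0` or `s` and the representative of its orbit, an even one with two members of the
spread transversal. -/
theorem isMaximalDistinctSumFree_transversalSet (hs : s + s = 0) (hχ : χ s = 0)
    (hf : f ∈ transversals χ s) (hspread : IsSpread χ s f) :
    IsMaximalDistinctSumFree (transversalSet χ s f) := by
  refine ⟨isDistinctSumFree_transversalSet hs hχ hf, fun T hT hlt => ?_⟩
  obtain ⟨hsub, w, hwT, hw⟩ := Set.ssubset_iff_exists.1 hlt
  have hodd : ∀ {a b : G}, χ a = 1 → χ b = 0 → a ≠ b := by
    rintro a b ha hb rfl
    simp [ha] at hb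
  have hR : ∀ {x}, x ∈ Set.range f → x ∈ T := fun hx => hsub (Or.inl hx)
  have h0T : (0 : G) ∈ T := hsub (Or.inr (by simp))
  have hsT : s ∈ T := hsub (Or.inr (by simp))
  have two : ∀ a : ZMod 2, a = 0 ∨ a = 1 := by decide
  rcases two (χ w) with h | h
  · rw [mem_pair_iff_of_even hχ hf h, not_or] at hw
    obtain ⟨x, hx, hxq, -, -⟩ := hspread w h hw.1 hw.2
    have hx1 := odd_of_mem_range hχ hf hx
    refine hT x (hR hx) w hwT (x + w) (hR hxq) ⟨rfl, hodd hx1 h, by simpa using hw.1, ?_⟩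
    simpa using hodd hx1 (map_zero χ)
  · rw [mem_range_iff_of_odd hχ h] at hw
    obtain ⟨y, hy, hyw⟩ := exists_mem_range_mem_signOrbit hf h
    have hy1 := odd_of_mem_range hχ hf hy
    have hne : w ≠ y := by rintro rfl; exact hw hy
    rw [mem_signOrbit] at hyw
    rcases hyw with hyw | hyw | hyw | hyw
    · exact hne hyw.symm
    · exact hT w hwT y (hR hy) 0 h0T ⟨by rw [hyw]; simp, hne, hodd h (map_zero χ),
        hodd hy1 (map_zero χ)⟩
    · exact hT w hwT s hsT y (hR hy) ⟨hyw.symm, hodd h hχ, hne, (hodd hy1 hχ).symm⟩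
    · exact hT w hwT y (hR hy) s hsT ⟨by rw [hyw]; abel, hne, hodd h hχ, hodd hy1 hχ⟩

theorem transversalSet_injOn (hs : s + s = 0) (hχ : χ s = 0) :
    Set.InjOn (transversalSet χ s) (transversals χ s : Set ({o // o ∈ oddOrbits χ s} → G)) := by
  intro f hf g hg h
  funext o
  have h1 : f o ∈ Set.range f := ⟨o, rfl⟩
  have hodd := odd_of_mem_range hχ hf h1
  rw [← mem_range_iff_of_odd hχ hodd, h, mem_range_iff_of_odd hχ hodd] at h1
  refine eq_of_mem_range_of_mem_signOrbit hs hg ⟨o, rfl⟩ h1 ?_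
  rw [← eq_signOrbit_of_mem hs o.2 (mem_transversals.1 hg o)]
  exact mem_transversals.1 hf o

omit [DecidableEq G] in
theorem exists_even_odd_ne (hG : 4 < Fintype.card G) {χ χ' : G →+ ZMod 2} (hne' : χ' ≠ 0)
    (h : χ ≠ χ') (s : G) : ∃ q, χ q = 0 ∧ χ' q = 1 ∧ q ≠ s := by
  have two : ∀ a : ZMod 2, a = 0 ∨ a = 1 := by decide
  have key : ∃ q, χ q = 0 ∧ χ' q = 1 := by
    obtain ⟨a, ha⟩ := DFunLike.ne_iff.1 h
    obtain ⟨b, hb⟩ := DFunLike.ne_iff.1 hne'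
    have hb1 : χ' b = 1 := (two _).resolve_left hb
    rcases two (χ a) with h1 | h1 <;> rcases two (χ' a) with h2 | h2
    · exact absurd (h1.trans h2.symm) ha
    · exact ⟨a, h1, h2⟩
    · rcases two (χ b) with h3 | h3
      · exact ⟨b, h3, hb1⟩
      · exact ⟨a + b, by rw [map_add, h1, h3]; decide, by rw [map_add, h2, hb1, zero_add]⟩
    · exact absurd (h1.trans h2.symm) ha
  obtain ⟨q, hq, hq'⟩ := key
  by_cases hqs : q = s
  · -- By pigeonhole some nonzero element lies in both kernels; translating `q` by it avoids `s`.
    obtain ⟨a, b, hab, he⟩ := Fintype.exists_ne_map_eq_of_card_lt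
      (fun x => (χ x, χ' x)) (by simpa [ZMod.card] using hG)
    simp only [Prod.mk.injEq] at he
    refine ⟨q + (a - b), by simp [hq, he.1], by simp [hq', he.2], ?_⟩
    rw [← hqs]
    simpa [sub_eq_zero] using hab
  · exact ⟨q, hq, hq', hqs⟩

theorem hom_eq_of_transversalSet_eq {χ' : G →+ ZMod 2} {s' : G}
    {f' : {o // o ∈ oddOrbits χ' s'} → G} (hG : 4 < Fintype.card G)
    (hspread : IsSpread χ s f) (hs' : s' + s' = 0) (hne' : χ' ≠ 0) (hf' : f' ∈ transversals χ' s')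
    (hχ' : χ' s' = 0) (h : transversalSet χ s f = transversalSet χ' s' f') : χ = χ' := by
  by_contra hne
  obtain ⟨q, hq, hq', hqs⟩ := exists_even_odd_ne hG hne' hne s
  have hq0 : q ≠ 0 := by rintro rfl; simp at hq'
  obtain ⟨x, hx, hxq, h1, h2⟩ := hspread q hq hq0 hqs
  have odd : ∀ y, y ∈ Set.range f → y + y ≠ 0 → χ' y = 1 := by
    intro y hy hyy
    have hy' : y ∈ transversalSet χ' s' f' := h ▸ Or.inl hy
    rcases hy' with hy' | rfl | rfl
    · exact odd_of_mem_range hχ' hf' hy'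
    · simp at hyy
    · exact absurd hs' hyy
  have h3 := odd _ hxq h2
  rw [map_add, odd _ hx h1, hq'] at h3
  exact absurd h3 (by decide)

/-- The pair `(χ, s)` is determined by the set `transversalSet χ s f` of a spread transversal. -/
theorem eq_and_eq_of_transversalSet_eq {χ' : G →+ ZMod 2} {s' : G}
    {f' : {o // o ∈ oddOrbits χ' s'} → G} (hG : 4 < Fintype.card G)
    (hχ : χ s = 0) (hf : f ∈ transversals χ s) (hspread : IsSpread χ s f)
    (hs' : s' + s' = 0) (hχ' : χ' s' = 0) (hne' : χ' ≠ 0) (hf' : f' ∈ transversals χ' s')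
    (h : transversalSet χ s f = transversalSet χ' s' f') : χ = χ' ∧ s = s' := by
  obtain rfl := hom_eq_of_transversalSet_eq hG hspread hs' hne' hf' hχ' h
  refine ⟨rfl, ?_⟩
  have h1 : s = 0 ∨ s = s' := (mem_pair_iff_of_even hχ' hf' hχ).1 (h ▸ Or.inr (by simp))
  have h2 : s' = 0 ∨ s' = s := (mem_pair_iff_of_even hχ hf hχ').1 (h ▸ Or.inr (by simp))
  rcases h1 with rfl | h1
  · rcases h2 with h2 | h2 <;> exact h2.symm
  · exact h1

/-- Distinct pairs `(χ, s)` contribute disjoint families of maximal distinct sum-free sets, one for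
each spread transversal. -/
theorem sum_card_spread_le_fStarMax (hG : 4 < Fintype.card G)
    (P : Finset ((G →+ ZMod 2) × G)) (hP : ∀ p ∈ P, p.1 ≠ 0 ∧ p.2 + p.2 = 0 ∧ p.1 p.2 = 0)
    [∀ p : (G →+ ZMod 2) × G, DecidablePred (IsSpread p.1 p.2)] :
    ∑ p ∈ P, ((transversals p.1 p.2).filter (IsSpread p.1 p.2)).card ≤ fStarMax G := by
  classical
  let F : (G →+ ZMod 2) × G → Finset (Set G) := fun p =>
    ((transversals p.1 p.2).filter (IsSpread p.1 p.2)).image (transversalSet p.1 p.2)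
  have hcard : ∀ p ∈ P,
      ((transversals p.1 p.2).filter (IsSpread p.1 p.2)).card = (F p).card := by
    intro p hp
    obtain ⟨-, h1, h2⟩ := hP p hp
    refine (Finset.card_image_of_injOn ?_).symm
    exact (transversalSet_injOn h1 h2).mono fun f hf => (Finset.mem_filter.1 hf).1
  rw [Finset.sum_congr rfl hcard, ← Finset.card_biUnion, fStarMax, ← Set.ncard_coe_finset]
  · refine Set.ncard_le_ncard ?_ (Set.toFinite _)
    intro M hM
    simp only [Finset.coe_biUnion, Set.mem_iUnion, F, Finset.coe_image, Set.mem_image,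
      Finset.mem_coe, Finset.mem_filter] at hM
    obtain ⟨p, hp, f, ⟨hf, hfs⟩, rfl⟩ := hM
    obtain ⟨-, h1, h2⟩ := hP p hp
    exact isMaximalDistinctSumFree_transversalSet h1 h2 hf hfs
  · intro p hp p' hp' hne
    rw [Function.onFun, Finset.disjoint_left]
    intro M hM hM'
    simp only [F, Finset.mem_image, Finset.mem_filter] at hM hM'
    obtain ⟨f, ⟨hf, hfs⟩, rfl⟩ := hM
    obtain ⟨f', ⟨hf', -⟩, h⟩ := hM'
    obtain ⟨-, h1, h2⟩ := hP p hp
    obtain ⟨h3, h4, h5⟩ := hP p' hp'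
    obtain ⟨e1, e2⟩ := eq_and_eq_of_transversalSet_eq hG h2 hf hfs h4 h5 h3 hf' h.symm
    exact hne (Prod.ext e1 e2)

end Construction

/-! ### Few transversals fail to be spread -/

section Avoidance

/-- Each of the pairwise disjoint coordinate pairs `(i k, j k)` takes a prescribed pair of values
with proportion at least `1 / 16`, independently of the others. -/
theorem card_piFinset_avoid_le {ι α κ : Type*} [Fintype ι] [DecidableEq ι] [DecidableEq α]
    [DecidableEq κ]
    (t : ι → Finset α) (ht : ∀ i, (t i).card ≤ 4) (i j : κ → ι) (a b : κ → α) (Y : Finset κ)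
    (ha : ∀ k ∈ Y, a k ∈ t (i k)) (hb : ∀ k ∈ Y, b k ∈ t (j k)) (hij : ∀ k ∈ Y, i k ≠ j k)
    (hdis : ∀ k ∈ Y, ∀ l ∈ Y, k ≠ l → i k ≠ i l ∧ i k ≠ j l ∧ j k ≠ i l ∧ j k ≠ j l) :
    16 ^ Y.card *
        ((Fintype.piFinset t).filter fun f => ∀ k ∈ Y, ¬(f (i k) = a k ∧ f (j k) = b k)).card
      ≤ 15 ^ Y.card * (Fintype.piFinset t).card := by
  induction Y using Finset.induction_on with
  | empty => simp
  | insert k Y hk ih =>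
    have ih := ih (fun l hl => ha l (by simp [hl])) (fun l hl => hb l (by simp [hl]))
      (fun l hl => hij l (by simp [hl]))
      (fun l hl m hm => hdis l (by simp [hl]) m (by simp [hm]))
    set N := (Fintype.piFinset t).filter
      fun f => ∀ l ∈ Y, ¬(f (i l) = a l ∧ f (j l) = b l) with hN
    have hnew : ((Fintype.piFinset t).filter
        fun f => ∀ l ∈ insert k Y, ¬(f (i l) = a l ∧ f (j l) = b l))
        = N.filter fun f => ¬(f (i k) = a k ∧ f (j k) = b k) := by
      ext f
      simp only [hN, Finset.mem_filter, Finset.mem_insert, forall_eq_or_imp]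
      tauto
    have hk' := hij k (by simp)
    -- Overwriting the coordinates `i k` and `j k` by the prescribed values loses at most `4 * 4`
    -- choices and does not affect the other constraints.
    have hfib : N.card ≤ (N.filter fun f => f (i k) = a k ∧ f (j k) = b k).card * (4 * 4) := by
      calc N.card ≤ ((N.filter fun f => f (i k) = a k ∧ f (j k) = b k)
            ×ˢ (t (i k) ×ˢ t (j k))).card := by
            refine Finset.card_le_card_of_injOn
              (fun f => (Function.update (Function.update f (i k) (a k)) (j k) (b k),
                f (i k), f (j k))) ?_ ?_
            · intro f hf
              simp only [hN, Finset.coe_filter, Set.mem_ofPred_eq, Fintype.mem_piFinset] at hf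
              simp only [hN, Finset.coe_product, Set.mem_prod, Finset.mem_coe, Finset.mem_filter,
                Fintype.mem_piFinset, hf.1, and_true, Function.update_self, ne_eq, hk',
                not_false_eq_true, Function.update_of_ne]
              refine ⟨fun x => ?_, fun l hl => ?_⟩
              · by_cases h1 : x = j k
                · subst h1; simpa using hb k (by simp)
                · by_cases h2 : x = i k
                  · subst h2; simpa [h1] using ha k (by simp)
                  · simpa [h1, h2] using hf.1 x
              · have hlk : l ≠ k := by rintro rfl; exact hk hl
                obtain ⟨h1, h2, h3, h4⟩ := hdis l (by simp [hl]) k (by simp) hlk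
                simpa [h1, h2, h3, h4] using hf.2 l hl
            · intro f _ g _ h
              simp only [Prod.mk.injEq] at h
              obtain ⟨h1, h2, h3⟩ := h
              funext x
              by_cases hx1 : x = i k
              · rw [hx1, h2]
              · by_cases hx2 : x = j k
                · rw [hx2, h3]
                · simpa [hx1, hx2] using congrFun h1 x
        _ ≤ _ := by
            rw [Finset.card_product, Finset.card_product]
            exact Nat.mul_le_mul_left _ (Nat.mul_le_mul (ht _) (ht _))
    have hsplit := Finset.card_filter_add_card_filter_not (s := N)
      (fun f => f (i k) = a k ∧ f (j k) = b k)
    rw [hnew, Finset.card_insert_of_notMem hk, pow_succ, pow_succ]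
    have h15 : 16 * (N.filter fun f => ¬(f (i k) = a k ∧ f (j k) = b k)).card ≤ 15 * N.card := by
      omega
    calc 16 ^ Y.card * 16 * (N.filter fun f => ¬(f (i k) = a k ∧ f (j k) = b k)).card
        = 16 ^ Y.card * (16 * (N.filter fun f => ¬(f (i k) = a k ∧ f (j k) = b k)).card) := by ring
      _ ≤ 16 ^ Y.card * (15 * N.card) := Nat.mul_le_mul_left _ h15
      _ = 15 * (16 ^ Y.card * N.card) := by ring
      _ ≤ 15 * (15 ^ Y.card * (Fintype.piFinset t).card) := Nat.mul_le_mul_left _ ih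
      _ = _ := by ring

/-- A form of `card_piFinset_avoid_le` in which the family of avoiding functions is arbitrary. -/
theorem card_le_of_avoid {ι α κ : Type*} [Fintype ι] [DecidableEq ι] [DecidableEq α]
    [DecidableEq κ]
    (t : ι → Finset α) (ht : ∀ i, (t i).card ≤ 4) (i j : κ → ι) (a b : κ → α) (Y : Finset κ)
    (ha : ∀ k ∈ Y, a k ∈ t (i k)) (hb : ∀ k ∈ Y, b k ∈ t (j k)) (hij : ∀ k ∈ Y, i k ≠ j k)
    (hdis : ∀ k ∈ Y, ∀ l ∈ Y, k ≠ l → i k ≠ i l ∧ i k ≠ j l ∧ j k ≠ i l ∧ j k ≠ j l)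
    (B : Finset (ι → α)) (hB : B ⊆ Fintype.piFinset t)
    (havoid : ∀ f ∈ B, ∀ k ∈ Y, ¬(f (i k) = a k ∧ f (j k) = b k)) :
    16 ^ Y.card * B.card ≤ 15 ^ Y.card * (Fintype.piFinset t).card :=
  (Nat.mul_le_mul_left _ (Finset.card_le_card fun f hf =>
    Finset.mem_filter.2 ⟨hB hf, havoid f hf⟩)).trans
    (card_piFinset_avoid_le t ht i j a b Y ha hb hij hdis)

/-- A greedy choice: if every element conflicts with at most `d` others, counting itself, then a
`1 / d` proportion of `X` is free of conflicts. -/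
theorem exists_subset_pairwise_of_card_le {κ : Type*} [DecidableEq κ] (X : Finset κ) (d : ℕ)
    (c : κ → Finset κ) (hself : ∀ x, x ∈ c x) (hc : ∀ x, (c x).card ≤ d) :
    ∃ Y ⊆ X, (∀ x ∈ Y, ∀ y ∈ Y, x ≠ y → x ∉ c y ∨ y ∉ c x) ∧ X.card ≤ Y.card * d := by
  obtain ⟨Y, hY⟩ := Finset.exists_maximal (s := X.powerset.filter
    fun Y => ∀ x ∈ Y, ∀ y ∈ Y, x ≠ y → x ∉ c y ∨ y ∉ c x) ⟨∅, by simp⟩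
  have hYm := hY.1
  simp only [Finset.mem_filter, Finset.mem_powerset] at hYm
  refine ⟨Y, hYm.1, hYm.2, ?_⟩
  have hcov : X ⊆ Y.biUnion c := by
    intro x hx
    rw [Finset.mem_biUnion]
    by_contra! hcon
    have hins : insert x Y ∈ X.powerset.filter
        fun Y => ∀ x ∈ Y, ∀ y ∈ Y, x ≠ y → x ∉ c y ∨ y ∉ c x := by
      simp only [Finset.mem_filter, Finset.mem_powerset, Finset.insert_subset_iff]
      refine ⟨⟨hx, hYm.1⟩, fun a ha b hb hab => ?_⟩
      rw [Finset.mem_insert] at ha hb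
      rcases ha with rfl | ha <;> rcases hb with rfl | hb
      · exact absurd rfl hab
      · exact Or.inl (hcon b hb)
      · exact Or.inr (hcon a ha)
      · exact hYm.2 a ha b hb hab
    have := hY.2 hins (Finset.subset_insert x Y) (Finset.mem_insert_self x Y)
    exact hcon x this (hself x)
  exact (Finset.card_le_card hcov).trans (Finset.card_biUnion_le_card_mul _ _ _ fun x _ => hc x)

end Avoidance


section Counting

variable {G : Type*} [AddCommGroup G] [DecidableEq G] [Fintype G] {χ : G →+ ZMod 2} {s : G}

/-- The elements killed by `2`. -/
def twoTorsion (G : Type*) [AddCommGroup G] [DecidableEq G] [Fintype G] : Finset G :=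
  Finset.univ.filter fun x => x + x = 0

@[simp] theorem mem_twoTorsion {x : G} : x ∈ twoTorsion G ↔ x + x = 0 := by simp [twoTorsion]

/-- The equation `2x = c` has at most as many solutions as `2x = 0`. -/
theorem card_filter_add_self_eq_le (c : G) :
    (Finset.univ.filter fun x : G => x + x = c).card ≤ (twoTorsion G).card := by
  rcases (Finset.univ.filter fun x : G => x + x = c).eq_empty_or_nonempty with h | ⟨a, ha⟩
  · simp [h]
  · refine Finset.card_le_card_of_injOn (fun x => x - a) ?_ (by intro x _ y _ h; simpa using h)
    intro x hx
    simp only [Finset.coe_filter, Finset.mem_univ, true_and, Set.mem_ofPred_eq,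
      Finset.mem_filter] at hx ha
    simp only [Finset.mem_coe, mem_twoTorsion]
    rw [sub_add_sub_comm, hx, ha, sub_self]

/-- The members `x` of the odd coset for which `x` and `x + q` lie in distinct orbits and are not
killed by `2`. -/
def usableElements (χ : G →+ ZMod 2) (s q : G) : Finset G :=
  (oddCoset χ).filter fun x =>
    x + x ≠ 0 ∧ (x + q) + (x + q) ≠ 0 ∧ signOrbit s x ≠ signOrbit s (x + q)

theorem card_oddCoset_le_usableElements {q : G} (h0 : q ≠ 0) (hqs : q ≠ s) :
    (oddCoset χ).card ≤ (usableElements χ s q).card + 4 * (twoTorsion G).card := by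
  let A : G → Finset G := fun c => Finset.univ.filter fun x : G => x + x = c
  have hA : ∀ c, (A c).card ≤ (twoTorsion G).card := card_filter_add_self_eq_le
  have hcov : oddCoset χ ⊆
      usableElements χ s q ∪ (A 0 ∪ (A (-q - q) ∪ (A (-q) ∪ A (s - q)))) := by
    intro x hx
    by_contra hcon
    simp only [A, usableElements, Finset.mem_union, Finset.mem_filter, Finset.mem_univ, true_and,
      not_or, not_and, hx] at hcon
    obtain ⟨h1, h2, h3, h4, h5⟩ := hcon
    refine h1 h2 (fun h => h3 ?_) (fun h => ?_)
    · rw [← sub_eq_zero, ← h]; abel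
    · have hmem := self_mem_signOrbit s (x + q)
      rw [← h, mem_signOrbit] at hmem
      rcases hmem with h | h | h | h
      · exact h0 (by simpa using h)
      · exact h4 (by rw [← sub_eq_zero] at h ⊢; rw [← h]; abel)
      · exact hqs (add_left_cancel h)
      · exact h5 (by rw [← sub_eq_zero] at h ⊢; rw [← h]; abel)
  have h1 := Finset.card_le_card hcov
  have h2 := Finset.card_union_le (usableElements χ s q) (A 0 ∪ (A (-q - q) ∪ (A (-q) ∪ A (s - q))))
  have h3 := Finset.card_union_le (A 0) (A (-q - q) ∪ (A (-q) ∪ A (s - q)))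
  have h4 := Finset.card_union_le (A (-q - q)) (A (-q) ∪ A (s - q))
  have h5 := Finset.card_union_le (A (-q)) (A (s - q))
  have := hA 0
  have := hA (-q - q)
  have := hA (-q)
  have := hA (s - q)
  omega

/-- The elements `y` for which `y` or `y + q` lies in the orbit of `x` or of `x + q`. -/
def conflictSet (s q x : G) : Finset G :=
  (signOrbit s x ∪ signOrbit s (x + q)) ∪
    (signOrbit s x ∪ signOrbit s (x + q)).image fun z => z - q

omit [Fintype G] in
theorem card_conflictSet_le (s q x : G) : (conflictSet s q x).card ≤ 16 := by
  have h1 := Finset.card_union_le (signOrbit s x ∪ signOrbit s (x + q))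
    ((signOrbit s x ∪ signOrbit s (x + q)).image fun z => z - q)
  have h2 := Finset.card_union_le (signOrbit s x) (signOrbit s (x + q))
  have h3 := Finset.card_image_le (s := signOrbit s x ∪ signOrbit s (x + q)) (f := fun z => z - q)
  have h4 := card_signOrbit_le s x
  have h5 := card_signOrbit_le s (x + q)
  rw [conflictSet]
  omega

omit [Fintype G] in
theorem signOrbit_ne_of_notMem_conflictSet {q x y : G} (h : y ∉ conflictSet s q x) :
    signOrbit s x ≠ signOrbit s y ∧ signOrbit s x ≠ signOrbit s (y + q) ∧
      signOrbit s (x + q) ≠ signOrbit s y ∧ signOrbit s (x + q) ≠ signOrbit s (y + q) := by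
  simp only [conflictSet, Finset.mem_union, Finset.mem_image, not_or, not_exists, not_and] at h
  obtain ⟨⟨h1, h2⟩, h3⟩ := h
  have h4 : ∀ z, signOrbit s z = signOrbit s (y + q) → y + q ∈ signOrbit s z :=
    fun z hz => hz ▸ self_mem_signOrbit s (y + q)
  refine ⟨fun h => h1 (h ▸ self_mem_signOrbit s y), fun h => ?_,
    fun h => h2 (h ▸ self_mem_signOrbit s y), fun h => ?_⟩
  · exact h3 (y + q) (Or.inl (h4 _ h)) (by simp)
  · exact h3 (y + q) (Or.inr (h4 _ h)) (by simp)

/-- Translation by `q` joins many disjoint pairs of orbits. -/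
theorem exists_disjoint_orbit_pairs {q : G} (h0 : q ≠ 0) (hqs : q ≠ s) :
    ∃ Y ⊆ usableElements χ s q, (oddCoset χ).card ≤ 16 * Y.card + 4 * (twoTorsion G).card ∧
      ∀ k ∈ Y, ∀ l ∈ Y, k ≠ l →
        signOrbit s k ≠ signOrbit s l ∧ signOrbit s k ≠ signOrbit s (l + q) ∧
        signOrbit s (k + q) ≠ signOrbit s l ∧ signOrbit s (k + q) ≠ signOrbit s (l + q) := by
  obtain ⟨Y, hYX, hY, hcard⟩ := exists_subset_pairwise_of_card_le (usableElements χ s q) 16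
    (conflictSet s q) (fun x => by simp [conflictSet, self_mem_signOrbit]) (card_conflictSet_le s q)
  refine ⟨Y, hYX, ?_, fun k hk l hl hkl => ?_⟩
  · have := card_oddCoset_le_usableElements (χ := χ) h0 hqs
    omega
  · rcases hY k hk l hl hkl with h | h
    · obtain ⟨h1, h2, h3, h4⟩ := signOrbit_ne_of_notMem_conflictSet h
      exact ⟨h1.symm, h3.symm, h2.symm, h4.symm⟩
    · exact signOrbit_ne_of_notMem_conflictSet h

/-- For a fixed `q`, the transversals in which `q` is not a difference of the required kind are
exponentially rare: each of the disjoint pairs of orbits joined by translation by `q` is avoided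
with proportion at most `15 / 16`. -/
theorem exists_card_avoid_le {q : G} (hq : χ q = 0) (h0 : q ≠ 0) (hqs : q ≠ s) :
    ∃ (m : ℕ) (B : Finset ({o // o ∈ oddOrbits χ s} → G)),
      (oddCoset χ).card ≤ 16 * m + 4 * (twoTorsion G).card ∧
      (∀ f ∈ transversals χ s,
        (¬∃ x ∈ Set.range f, x + q ∈ Set.range f ∧ x + x ≠ 0 ∧ (x + q) + (x + q) ≠ 0) → f ∈ B) ∧
      16 ^ m * B.card ≤ 15 ^ m * (transversals χ s).card := by
  classical
  obtain ⟨Y, hYX, hm, hY⟩ := exists_disjoint_orbit_pairs (χ := χ) h0 hqs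
  have huse : ∀ k ∈ Y, χ k = 1 ∧ k + k ≠ 0 ∧ (k + q) + (k + q) ≠ 0 ∧
      signOrbit s k ≠ signOrbit s (k + q) := by
    intro k hk
    simpa [usableElements] using hYX hk
  have hodd : ∀ k : {k // k ∈ Y}, χ (k.1 + q) = 1 := by
    intro k
    rw [map_add, (huse k.1 k.2).1, hq, add_zero]
  have hcard4 : ∀ o : {o // o ∈ oddOrbits χ s}, o.1.card ≤ 4 := by
    intro o
    obtain ⟨x, -, hx⟩ := Finset.mem_image.1 o.2
    rw [← hx]
    exact card_signOrbit_le s x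
  have key := card_le_of_avoid (fun o : {o // o ∈ oddOrbits χ s} => o.1) hcard4
    (fun k : {k // k ∈ Y} => orbitOf χ s ⟨k.1, (huse k.1 k.2).1⟩)
    (fun k : {k // k ∈ Y} => orbitOf χ s ⟨k.1 + q, hodd k⟩)
    (fun k => k.1) (fun k => k.1 + q) Finset.univ
    (fun k _ => self_mem_signOrbit s k.1) (fun k _ => self_mem_signOrbit s (k.1 + q))
    (fun k _ h => (huse k.1 k.2).2.2.2 (congrArg Subtype.val h))
    (fun k _ l _ hkl => by
      obtain ⟨h1, h2, h3, h4⟩ := hY k.1 k.2 l.1 l.2 (fun h => hkl (Subtype.ext h))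
      exact ⟨fun h => h1 (congrArg Subtype.val h), fun h => h2 (congrArg Subtype.val h),
        fun h => h3 (congrArg Subtype.val h), fun h => h4 (congrArg Subtype.val h)⟩)
  rw [Finset.card_univ, Fintype.card_coe] at key
  refine ⟨Y.card, (transversals χ s).filter fun f =>
    ¬∃ x ∈ Set.range f, x + q ∈ Set.range f ∧ x + x ≠ 0 ∧ (x + q) + (x + q) ≠ 0, hm,
    fun f hf havoid => Finset.mem_filter.2 ⟨hf, havoid⟩, key _ (Finset.filter_subset _ _) ?_⟩
  intro f hf k _ hfk
  exact (Finset.mem_filter.1 hf).2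
    ⟨k.1, ⟨_, hfk.1⟩, ⟨_, hfk.2⟩, (huse k.1 k.2).2.1, (huse k.1 k.2).2.2.1⟩

/-- A union bound over `q`. -/
theorem card_transversals_le_card_spread [DecidablePred (IsSpread χ s)] {δ : ℝ} (hδ : 0 ≤ δ)
    (h : ∀ m : ℕ, (oddCoset χ).card ≤ 16 * m + 4 * (twoTorsion G).card → (15 / 16 : ℝ) ^ m ≤ δ) :
    ((transversals χ s).card : ℝ) - Fintype.card G * (δ * (transversals χ s).card)
      ≤ ((transversals χ s).filter (IsSpread χ s)).card := by
  classical
  let Q : Finset G := Finset.univ.filter fun q => χ q = 0 ∧ q ≠ 0 ∧ q ≠ s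
  have hB : ∀ q : G, ∃ B : Finset ({o // o ∈ oddOrbits χ s} → G), q ∈ Q →
      (∀ f ∈ transversals χ s,
        (¬∃ x ∈ Set.range f, x + q ∈ Set.range f ∧ x + x ≠ 0 ∧ (x + q) + (x + q) ≠ 0) → f ∈ B) ∧
      (B.card : ℝ) ≤ δ * (transversals χ s).card := by
    intro q
    by_cases hq : q ∈ Q
    · obtain ⟨h1, h2, h3⟩ := (Finset.mem_filter.1 hq).2
      obtain ⟨m, B, hm, hmem, hle⟩ := exists_card_avoid_le (s := s) h1 h2 h3
      refine ⟨B, fun _ => ⟨hmem, ?_⟩⟩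
      have hle' : (16 : ℝ) ^ m * B.card ≤ 15 ^ m * (transversals χ s).card := by
        exact_mod_cast hle
      have h16 : (0 : ℝ) < 16 ^ m := by positivity
      calc (B.card : ℝ) ≤ (15 / 16 : ℝ) ^ m * (transversals χ s).card := by
            rw [div_pow, div_mul_eq_mul_div, le_div_iff₀ h16]
            linarith
        _ ≤ _ := mul_le_mul_of_nonneg_right (h m hm) (by positivity)
    · exact ⟨∅, fun h => absurd h hq⟩
  choose B hB using hB
  have hbad : (transversals χ s).filter (fun f => ¬IsSpread χ s f) ⊆ Q.biUnion B := by
    intro f hf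
    rw [Finset.mem_filter, IsSpread] at hf
    obtain ⟨hf, hns⟩ := hf
    push Not at hns
    obtain ⟨q, h1, h2, h3, h4⟩ := hns
    have hq : q ∈ Q := by simp [Q, h1, h2, h3]
    refine Finset.mem_biUnion.2 ⟨q, hq, (hB q hq).1 f hf ?_⟩
    rintro ⟨x, hx, hxq, h5, h6⟩
    exact h6 (h4 x hx hxq h5)
  have h1 : (((transversals χ s).filter fun f => ¬IsSpread χ s f).card : ℝ)
      ≤ Fintype.card G * (δ * (transversals χ s).card) := by
    calc (((transversals χ s).filter fun f => ¬IsSpread χ s f).card : ℝ)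
        ≤ ∑ q ∈ Q, ((B q).card : ℝ) := by
          exact_mod_cast (Finset.card_le_card hbad).trans Finset.card_biUnion_le
      _ ≤ ∑ _q ∈ Q, δ * (transversals χ s).card := Finset.sum_le_sum fun q hq => (hB q hq).2
      _ = Q.card * (δ * (transversals χ s).card) := by rw [Finset.sum_const, nsmul_eq_mul]
      _ ≤ _ := by
          refine mul_le_mul_of_nonneg_right ?_ (by positivity)
          exact_mod_cast Finset.card_le_univ Q
  have h2 : (((transversals χ s).filter (IsSpread χ s)).card : ℝ)
      + ((transversals χ s).filter fun f => ¬IsSpread χ s f).card = (transversals χ s).card := by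
    exact_mod_cast Finset.card_filter_add_card_filter_not (IsSpread χ s)
  linarith

omit [DecidableEq G] [Fintype G] in
/-- A nontrivial `χ` halves every set stable under translation by an odd element. -/
theorem two_mul_card_filter_odd (T : Finset G) {a : G} (ha : χ a = 1) (hadd : ∀ x ∈ T, x + a ∈ T)
    (hsub : ∀ x ∈ T, x - a ∈ T) :
    2 * (T.filter fun x => χ x = 1).card = T.card ∧
      2 * (T.filter fun x => χ x = 0).card = T.card := by
  have h1 : (T.filter fun x => χ x = 1).card = (T.filter fun x => χ x = 0).card := by
    refine Finset.card_bij' (fun x _ => x + a) (fun x _ => x - a) ?_ ?_ ?_ ?_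
    · intro x hx
      simp only [Finset.mem_filter] at hx ⊢
      exact ⟨hadd x hx.1, by rw [map_add, hx.2, ha]; decide⟩
    · intro x hx
      simp only [Finset.mem_filter] at hx ⊢
      exact ⟨hsub x hx.1, by rw [map_sub, hx.2, ha]; decide⟩
    · intro x _; simp
    · intro x _; simp
  have h2 : (T.filter fun x => ¬χ x = 1) = T.filter fun x => χ x = 0 := by
    refine Finset.filter_congr fun x _ => ?_
    have : ∀ a : ZMod 2, ¬a = 1 ↔ a = 0 := by decide
    exact this _
  have h3 := Finset.card_filter_add_card_filter_not (s := T) (fun x => χ x = 1)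
  rw [h2] at h3
  omega

omit [DecidableEq G] [Fintype G] in
theorem exists_odd (hne : χ ≠ 0) : ∃ a, χ a = 1 := by
  obtain ⟨b, hb⟩ := DFunLike.ne_iff.1 hne
  have two : ∀ a : ZMod 2, a = 0 ∨ a = 1 := by decide
  exact ⟨b, (two _).resolve_left hb⟩

omit [DecidableEq G] in
theorem two_mul_card_oddCoset (hne : χ ≠ 0) : 2 * (oddCoset χ).card = Fintype.card G := by
  obtain ⟨a, ha⟩ := exists_odd hne
  exact (two_mul_card_filter_odd Finset.univ ha (by simp) (by simp)).1

end Counting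

/-! ### Summing over homomorphisms and 2-torsion elements -/

section Summation

variable {G : Type*} [AddCommGroup G] [DecidableEq G] [Fintype G] {χ : G →+ ZMod 2} {s : G}

theorem card_transversals_of_ne_zero (hne : χ ≠ 0) (hs : s + s = 0) (hχ : χ s = 0) (h0 : s ≠ 0) :
    ((transversals χ s).card : ℝ) = (2 : ℝ) ^ ((Fintype.card G : ℝ) / 4) := by
  have h1 : ((transversals χ s).card : ℝ) ^ 2 = 2 ^ (oddCoset χ).card := by
    exact_mod_cast card_transversals_sq hs hχ h0
  have h2 : (2 : ℝ) * (oddCoset χ).card = Fintype.card G := by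
    exact_mod_cast two_mul_card_oddCoset hne
  rw [← sq_eq_sq₀ (by positivity) (by positivity), h1, ← Real.rpow_natCast, ← Real.rpow_mul_natCast
    (by norm_num), ← h2]
  congr 1
  push_cast
  ring

theorem card_transversals_zero (hne : χ ≠ 0) :
    ((transversals χ 0).card : ℝ) = (2 : ℝ) ^ ((Fintype.card G : ℝ) / 4
      - (((twoTorsion G).filter fun x => χ x = 1).card : ℝ) / 2) := by
  have h1 : ((transversals χ 0).card : ℝ) ^ 2
      * 2 ^ ((oddCoset χ).filter fun x => x + x = 0).card = 2 ^ (oddCoset χ).card := by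
    exact_mod_cast card_transversals_zero_sq χ
  have h2 : (2 : ℝ) * (oddCoset χ).card = Fintype.card G := by
    exact_mod_cast two_mul_card_oddCoset hne
  have h3 : ((oddCoset χ).filter fun x => x + x = 0) = (twoTorsion G).filter fun x => χ x = 1 := by
    ext x
    simp [and_comm]
  rw [h3] at h1
  have h4 : (0 : ℝ) < 2 ^ ((twoTorsion G).filter fun x => χ x = 1).card := by positivity
  rw [← sq_eq_sq₀ (by positivity) (by positivity), eq_div_of_mul_eq h4.ne' h1,
    ← Real.rpow_natCast, ← Real.rpow_natCast, ← Real.rpow_sub (by norm_num),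
    ← Real.rpow_mul_natCast (by norm_num), ← h2]
  congr 1
  push_cast
  ring

theorem card_transversals_le (hne : χ ≠ 0) (hs : s + s = 0) (hχ : χ s = 0) :
    ((transversals χ s).card : ℝ) ≤ (2 : ℝ) ^ ((Fintype.card G : ℝ) / 4) := by
  by_cases h0 : s = 0
  · subst h0
    rw [card_transversals_zero hne]
    refine Real.rpow_le_rpow_of_exponent_le (by norm_num) ?_
    have : (0 : ℝ) ≤ (((twoTorsion G).filter fun x => χ x = 1).card : ℝ) := by positivity
    linarith
  · exact (card_transversals_of_ne_zero hne hs hχ h0).le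

theorem sum_card_transversals (hne : χ ≠ 0) :
    ∑ s ∈ (twoTorsion G).filter (fun s => χ s = 0), ((transversals χ s).card : ℝ)
      = ((((twoTorsion G).filter fun s => χ s = 0).card : ℝ) - 1)
          * (2 : ℝ) ^ ((Fintype.card G : ℝ) / 4)
        + (2 : ℝ) ^ ((Fintype.card G : ℝ) / 4
          - (((twoTorsion G).filter fun x => χ x = 1).card : ℝ) / 2) := by
  have h0 : (0 : G) ∈ (twoTorsion G).filter fun s => χ s = 0 := by simp
  rw [← Finset.sum_erase_add _ _ h0, card_transversals_zero hne]
  congr 1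
  rw [Finset.sum_congr rfl (g := fun _ => (2 : ℝ) ^ ((Fintype.card G : ℝ) / 4)), Finset.sum_const,
    nsmul_eq_mul, Finset.card_erase_of_mem h0, Nat.cast_sub (Finset.card_pos.2 ⟨0, h0⟩),
    Nat.cast_one]
  intro s hs
  simp only [Finset.mem_erase, Finset.mem_filter, mem_twoTorsion] at hs
  exact card_transversals_of_ne_zero hne hs.2.1 hs.2.2 hs.1

theorem sum_card_transversals_of_vanishing (hne : χ ≠ 0) (h : ∀ x ∈ twoTorsion G, χ x = 0) :
    ∑ s ∈ (twoTorsion G).filter (fun s => χ s = 0), ((transversals χ s).card : ℝ)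
      = (twoTorsion G).card * (2 : ℝ) ^ ((Fintype.card G : ℝ) / 4) := by
  have h1 : ((twoTorsion G).filter fun x => χ x = 1) = ∅ := by
    refine Finset.filter_eq_empty_iff.2 fun x hx => ?_
    rw [h x hx]
    decide
  rw [sum_card_transversals hne, h1, Finset.filter_true_of_mem h, Finset.card_empty,
    Nat.cast_zero, zero_div, sub_zero]
  ring

theorem sum_card_transversals_of_not_vanishing (h : ∃ x ∈ twoTorsion G, χ x = 1) :
    ∑ s ∈ (twoTorsion G).filter (fun s => χ s = 0), ((transversals χ s).card : ℝ)
      = ((twoTorsion G).card / 2 - 1) * (2 : ℝ) ^ ((Fintype.card G : ℝ) / 4)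
        + (2 : ℝ) ^ ((Fintype.card G : ℝ) / 4 - ((twoTorsion G).card : ℝ) / 4) := by
  obtain ⟨a, ha, hχa⟩ := h
  have hne : χ ≠ 0 := by rintro rfl; simp at hχa
  rw [mem_twoTorsion] at ha
  obtain ⟨h1, h2⟩ := two_mul_card_filter_odd (twoTorsion G) hχa
    (fun x hx => by
      rw [mem_twoTorsion] at hx ⊢
      rw [add_add_add_comm, hx, ha, add_zero])
    (fun x hx => by
      rw [mem_twoTorsion] at hx ⊢
      rw [sub_add_sub_comm, hx, ha, sub_zero])
  have h1' : (2 : ℝ) * ((twoTorsion G).filter fun x => χ x = 1).card = (twoTorsion G).card := by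
    exact_mod_cast h1
  have h2' : (2 : ℝ) * ((twoTorsion G).filter fun x => χ x = 0).card = (twoTorsion G).card := by
    exact_mod_cast h2
  have h3 : (((twoTorsion G).filter fun x => χ x = 1).card : ℝ) / 2 = (twoTorsion G).card / 4 := by
    linarith
  have h4 : (((twoTorsion G).filter fun x => χ x = 0).card : ℝ) = (twoTorsion G).card / 2 := by
    linarith
  rw [sum_card_transversals hne, h3, h4]

/-- The lower bound in terms of the homomorphisms that vanish (`𝒳₀`) or do not vanish (`𝒳₁`) on
the 2-torsion, with an explicit error term. -/
theorem le_fStarMax (hG : 16 * (twoTorsion G).card ≤ Fintype.card G)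
    (𝒳₀ 𝒳₁ : Finset (G →+ ZMod 2))
    (h₀ : ∀ χ ∈ 𝒳₀, χ ≠ 0 ∧ ∀ x ∈ twoTorsion G, χ x = 0)
    (h₁ : ∀ χ ∈ 𝒳₁, ∃ x ∈ twoTorsion G, χ x = 1)
    (hcard : 𝒳₀.card + 𝒳₁.card ≤ Fintype.card G) :
    (𝒳₀.card : ℝ) * ((twoTorsion G).card * (2 : ℝ) ^ ((Fintype.card G : ℝ) / 4))
      + 𝒳₁.card * (((twoTorsion G).card / 2 - 1) * (2 : ℝ) ^ ((Fintype.card G : ℝ) / 4)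
        + (2 : ℝ) ^ ((Fintype.card G : ℝ) / 4 - ((twoTorsion G).card : ℝ) / 4))
      - (Fintype.card G : ℝ) ^ 3 * (15 / 16 : ℝ) ^ ((Fintype.card G : ℝ) / 64)
        * (2 : ℝ) ^ ((Fintype.card G : ℝ) / 4)
      ≤ fStarMax G := by
  classical
  set n := Fintype.card G with hn
  set N := (2 : ℝ) ^ ((n : ℝ) / 4) with hN
  set δ := (15 / 16 : ℝ) ^ ((n : ℝ) / 64) with hδ
  have hdisj : Disjoint 𝒳₀ 𝒳₁ := by
    rw [Finset.disjoint_left]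
    intro χ h h'
    obtain ⟨x, hx, hx1⟩ := h₁ χ h'
    rw [(h₀ χ h).2 x hx] at hx1
    exact absurd hx1 (by decide)
  have hne : ∀ χ ∈ 𝒳₀ ∪ 𝒳₁, χ ≠ 0 := by
    intro χ hχ
    rcases Finset.mem_union.1 hχ with h | h
    · exact (h₀ χ h).1
    · obtain ⟨x, -, hx⟩ := h₁ χ h
      rintro rfl
      simp at hx
  have ht : 0 < (twoTorsion G).card := Finset.card_pos.2 ⟨0, by simp⟩
  let P : Finset ((G →+ ZMod 2) × G) :=
    ((𝒳₀ ∪ 𝒳₁) ×ˢ twoTorsion G).filter fun p => p.1 p.2 = 0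
  have hP : ∀ p ∈ P, p.1 ≠ 0 ∧ p.2 + p.2 = 0 ∧ p.1 p.2 = 0 := by
    intro p hp
    simp only [P, Finset.mem_filter, Finset.mem_product, mem_twoTorsion] at hp
    exact ⟨hne _ hp.1.1, hp.1.2, hp.2⟩
  have hPcard : P.card ≤ n * n := by
    refine (Finset.card_filter_le _ _).trans ?_
    rw [Finset.card_product, Finset.card_union_of_disjoint hdisj]
    exact Nat.mul_le_mul hcard (Finset.card_le_univ _)
  have hδ0 : 0 ≤ δ := by positivity
  have hspread : ∀ p ∈ P, ((transversals p.1 p.2).card : ℝ) - n * (δ * N)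
      ≤ ((transversals p.1 p.2).filter (IsSpread p.1 p.2)).card := by
    intro p hp
    obtain ⟨h1, h2, h3⟩ := hP p hp
    refine le_trans ?_ (card_transversals_le_card_spread hδ0 fun m hm => ?_)
    · have := card_transversals_le h1 h2 h3
      gcongr
    · have h4 := two_mul_card_oddCoset h1
      have h5 : n ≤ 64 * m := by omega
      rw [hδ, ← Real.rpow_natCast]
      refine Real.rpow_le_rpow_of_exponent_ge (by norm_num) (by norm_num) ?_
      have h6 : (n : ℝ) ≤ 64 * m := by exact_mod_cast h5
      linarith
  have hsum : ∑ p ∈ P, ((transversals p.1 p.2).card : ℝ)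
      = (𝒳₀.card : ℝ) * ((twoTorsion G).card * N)
        + 𝒳₁.card * (((twoTorsion G).card / 2 - 1) * N
          + (2 : ℝ) ^ ((n : ℝ) / 4 - ((twoTorsion G).card : ℝ) / 4)) := by
    rw [Finset.sum_filter, Finset.sum_product]
    simp only [← Finset.sum_filter]
    rw [Finset.sum_union hdisj,
      Finset.sum_congr rfl fun χ hχ => sum_card_transversals_of_vanishing (h₀ χ hχ).1 (h₀ χ hχ).2,
      Finset.sum_congr rfl fun χ hχ => sum_card_transversals_of_not_vanishing (h₁ χ hχ),
      Finset.sum_const, Finset.sum_const, nsmul_eq_mul, nsmul_eq_mul]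
  have hle : (∑ p ∈ P, (((transversals p.1 p.2).filter (IsSpread p.1 p.2)).card : ℝ))
      ≤ fStarMax G := by
    exact_mod_cast sum_card_spread_le_fStarMax (by omega) P hP
  have hge := Finset.sum_le_sum hspread
  rw [Finset.sum_sub_distrib, hsum, Finset.sum_const, nsmul_eq_mul] at hge
  have herr : (P.card : ℝ) * (n * (δ * N)) ≤ (n : ℝ) ^ 3 * δ * N := by
    have h1 : (P.card : ℝ) ≤ n * n := by exact_mod_cast hPcard
    calc (P.card : ℝ) * (n * (δ * N)) ≤ (n * n) * (n * (δ * N)) :=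
          mul_le_mul_of_nonneg_right h1 (by positivity)
      _ = _ := by ring
  linarith

/-- The error term is negligible: `15 / 16` to the power `1 / 64` times `2` to the power `1 / 2816`
is less than `1`, because `(15 / 16) ^ 44 * 2 < 1`. -/
theorem exists_forall_error_le {η : ℝ} (hη : 0 < η) : ∃ n₀ : ℕ, 0 < n₀ ∧ ∀ n : ℕ, n₀ ≤ n →
    (n : ℝ) ^ 3 * (15 / 16 : ℝ) ^ ((n : ℝ) / 64) * (2 : ℝ) ^ ((n : ℝ) / 2816) ≤ η := by
  set ρ : ℝ := (15 / 16 : ℝ) ^ (1 / 64 : ℝ) * (2 : ℝ) ^ (1 / 2816 : ℝ) with hρ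
  have hρ0 : 0 ≤ ρ := by positivity
  have hρ1 : ρ < 1 := by
    have h : ρ ^ 2816 = (15 / 16 : ℝ) ^ 44 * 2 := by
      rw [hρ, mul_pow, ← Real.rpow_mul_natCast (by norm_num), ← Real.rpow_mul_natCast (by norm_num),
        ← Real.rpow_natCast]
      norm_num
    refine (pow_lt_one_iff_of_nonneg hρ0 (n := 2816) (by norm_num)).1 ?_
    rw [h]
    norm_num
  have hlim := tendsto_pow_const_mul_const_pow_of_abs_lt_one 3 (r := ρ) (by rwa [abs_of_nonneg hρ0])
  obtain ⟨n₀, hn₀⟩ := Filter.eventually_atTop.1 (hlim.eventually (ge_mem_nhds hη))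
  refine ⟨n₀ + 1, by omega, fun n hn => ?_⟩
  refine le_of_eq_of_le ?_ (hn₀ n (by omega))
  rw [hρ, mul_pow, ← Real.rpow_mul_natCast (by norm_num), ← Real.rpow_mul_natCast (by norm_num),
    mul_assoc]
  congr 3 <;> ring

end Summation

/-! ### The 2-torsion and the homomorphisms to `ZMod 2` -/

section Structure

theorem two_pow_dvd_of_add_self_eq_zero {a : ℕ} {x : ZMod (2 ^ (a + 1))} (hx : x + x = 0) :
    2 ^ a ∣ x.val := by
  have : NeZero (2 ^ (a + 1)) := ⟨by positivity⟩
  have h : ((2 * x.val : ℕ) : ZMod (2 ^ (a + 1))) = 0 := by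
    rw [two_mul, Nat.cast_add, ZMod.natCast_zmod_val, hx]
  rw [ZMod.natCast_eq_zero_iff] at h
  obtain ⟨c, hc⟩ := h
  refine ⟨c, Nat.eq_of_mul_eq_mul_left two_pos ?_⟩
  rw [hc]
  ring

theorem natCard_add_self_eq_zero_zmod {a : ℕ} (ha : 1 ≤ a) :
    Nat.card {x : ZMod (2 ^ a) // x + x = 0} = 2 := by
  obtain ⟨b, rfl⟩ : ∃ b, a = b + 1 := ⟨a - 1, by omega⟩
  have : NeZero (2 ^ (b + 1)) := ⟨by positivity⟩
  have hset : {x : ZMod (2 ^ (b + 1)) | x + x = 0} = {0, ((2 ^ b : ℕ) : ZMod (2 ^ (b + 1)))} := by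
    ext x
    simp only [Set.mem_ofPred_eq, Set.mem_insert_iff, Set.mem_singleton_iff]
    constructor
    · intro hx
      obtain ⟨k, hk⟩ := two_pow_dvd_of_add_self_eq_zero hx
      have hlt := x.val_lt
      rw [hk, pow_succ] at hlt
      have hk2 : k < 2 := Nat.lt_of_mul_lt_mul_left hlt
      rw [← ZMod.natCast_zmod_val x, hk]
      interval_cases k <;> simp
    · rintro (rfl | rfl)
      · simp
      · rw [← Nat.cast_add, ZMod.natCast_eq_zero_iff, pow_succ]
        exact ⟨1, by ring⟩
  have hne : (0 : ZMod (2 ^ (b + 1))) ≠ ((2 ^ b : ℕ) : ZMod (2 ^ (b + 1))) := by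
    intro h
    have h := (ZMod.natCast_eq_zero_iff _ _).1 h.symm
    exact absurd (Nat.le_of_dvd (by positivity) h) (by simp [pow_succ])
  have := Set.ncard_pair hne
  rwa [← hset] at this

theorem eq_zero_of_add_self_of_odd {K : Type*} [AddCommGroup K] (hK : Odd (Nat.card K)) {x : K}
    (hx : x + x = 0) : x = 0 := by
  have h1 : addOrderOf x ∣ 2 := addOrderOf_dvd_of_nsmul_eq_zero (by rw [two_nsmul, hx])
  have h2 : addOrderOf x ∣ Nat.card K := addOrderOf_dvd_natCard x
  have h3 : addOrderOf x ∣ 1 := by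
    rw [← (Nat.coprime_two_left.2 hK)]
    exact Nat.dvd_gcd h1 h2
  exact AddMonoid.addOrderOf_eq_one_iff.1 (Nat.dvd_one.1 h3)

variable {K : Type*} [AddCommGroup K] {r₁ r₂ : ℕ} {α : Fin r₁ → ℕ}

theorem natCard_add_self_eq_zero_prod (hK : Odd (Nat.card K)) (hα : ∀ i, 2 ≤ α i) :
    Nat.card {x : (∀ i : Fin r₁, ZMod (2 ^ α i)) × (Fin r₂ → ZMod 2) × K // x + x = 0}
      = 2 ^ (r₁ + r₂) := by
  let e : {x : (∀ i : Fin r₁, ZMod (2 ^ α i)) × (Fin r₂ → ZMod 2) × K // x + x = 0} ≃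
      (∀ i : Fin r₁, {x : ZMod (2 ^ α i) // x + x = 0}) × (Fin r₂ → ZMod 2) :=
    { toFun := fun x => (fun i => ⟨x.1.1 i, congrFun (congrArg Prod.fst x.2) i⟩, x.1.2.1)
      invFun := fun y => ⟨(fun i => (y.1 i).1, y.2, 0), by
        refine Prod.ext (funext fun i => (y.1 i).2) (Prod.ext (funext fun j => ?_) (add_zero 0))
        exact CharTwo.add_self_eq_zero _⟩
      left_inv := fun x => Subtype.ext (Prod.ext rfl (Prod.ext rfl
        (eq_zero_of_add_self_of_odd hK (congrArg (fun z => z.2.2) x.2)).symm))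
      right_inv := fun y => rfl }
  rw [Nat.card_congr e, Nat.card_prod, Nat.card_pi, Nat.card_pi, pow_add]
  congr 1
  · rw [Finset.prod_congr rfl fun i _ => natCard_add_self_eq_zero_zmod (by linarith [hα i])]
    simp
  · simp

/-- The homomorphism to `ZMod 2` with coefficients `u` on the cyclic factors of order at least `4`
and `v` on the factors of order `2`. -/
noncomputable def coordHom (K : Type*) [AddCommGroup K] (hα : ∀ i, 2 ≤ α i)
    (w : (Fin r₁ → ZMod 2) × (Fin r₂ → ZMod 2)) :
    ((∀ i : Fin r₁, ZMod (2 ^ α i)) × (Fin r₂ → ZMod 2) × K) →+ ZMod 2 :=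
  AddMonoidHom.mk' (fun x =>
    ∑ i, w.1 i * ZMod.castHom (dvd_pow_self 2 (by linarith [hα i] : α i ≠ 0)) (ZMod 2) (x.1 i)
      + ∑ j, w.2 j * x.2.1 j) (by
    intro x y
    simp only [Prod.fst_add, Prod.snd_add, Pi.add_apply, map_add, mul_add, Finset.sum_add_distrib]
    abel)

theorem coordHom_apply (hα : ∀ i, 2 ≤ α i) (w : (Fin r₁ → ZMod 2) × (Fin r₂ → ZMod 2))
    (x : (∀ i : Fin r₁, ZMod (2 ^ α i)) × (Fin r₂ → ZMod 2) × K) :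
    coordHom K hα w x =
      ∑ i, w.1 i * ZMod.castHom (dvd_pow_self 2 (by linarith [hα i] : α i ≠ 0)) (ZMod 2) (x.1 i)
        + ∑ j, w.2 j * x.2.1 j := rfl

theorem coordHom_single_left (hα : ∀ i, 2 ≤ α i) (w : (Fin r₁ → ZMod 2) × (Fin r₂ → ZMod 2))
    (i : Fin r₁) : coordHom K hα w (Pi.single i 1, 0, 0) = w.1 i := by
  rw [coordHom_apply, Finset.sum_eq_single i]
  · simp only [Pi.single_eq_same, map_one, mul_one, Pi.zero_apply, mul_zero, Finset.sum_const_zero,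
      add_zero]
  · intro j _ hj
    simp [hj]
  · simp

theorem coordHom_single_right (hα : ∀ i, 2 ≤ α i) (w : (Fin r₁ → ZMod 2) × (Fin r₂ → ZMod 2))
    (j : Fin r₂) : coordHom K hα w (0, Pi.single j 1, 0) = w.2 j := by
  rw [coordHom_apply, add_comm, Finset.sum_eq_single j]
  · simp
  · intro i _ hi
    simp [hi]
  · simp

theorem coordHom_injective (hα : ∀ i, 2 ≤ α i) :
    Function.Injective (coordHom (r₂ := r₂) K hα) := by
  intro w w' h
  refine Prod.ext (funext fun i => ?_) (funext fun j => ?_)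
  · rw [← coordHom_single_left (K := K) hα w i, h, coordHom_single_left]
  · rw [← coordHom_single_right (K := K) hα w j, h, coordHom_single_right]

/-- Elements killed by `2` have even coordinates in the cyclic factors of order at least `4`. -/
theorem coordHom_eq_zero_of_add_self (hα : ∀ i, 2 ≤ α i) (u : Fin r₁ → ZMod 2)
    {x : (∀ i : Fin r₁, ZMod (2 ^ α i)) × (Fin r₂ → ZMod 2) × K} (hx : x + x = 0) :
    coordHom K hα (u, 0) x = 0 := by
  rw [coordHom_apply, Finset.sum_eq_zero, zero_add]
  · simp
  · intro i _
    have hi : x.1 i + x.1 i = 0 := congrFun (congrArg Prod.fst hx) i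
    have key : ∀ (a : ℕ) (h : 2 ∣ 2 ^ a), 2 ≤ a → ∀ y : ZMod (2 ^ a), y + y = 0 →
        ZMod.castHom h (ZMod 2) y = 0 := by
      intro a h ha y hy
      obtain ⟨b, rfl⟩ : ∃ b, a = b + 1 := ⟨a - 1, by omega⟩
      have : NeZero (2 ^ (b + 1)) := ⟨by positivity⟩
      rw [← ZMod.natCast_zmod_val y, map_natCast, ZMod.natCast_eq_zero_iff]
      exact (dvd_pow_self 2 (by omega)).trans (two_pow_dvd_of_add_self_eq_zero hy)
    simp [key _ _ (hα i) _ hi]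

end Structure

/-! ### The lower bound -/

section Main

variable {G : Type*} [AddCommGroup G] [DecidableEq G] [Fintype G] {K : Type*} [AddCommGroup K]
  {r₁ r₂ : ℕ} {α : Fin r₁ → ℕ}

theorem card_twoTorsion (hK : Odd (Nat.card K)) (hα : ∀ i, 2 ≤ α i)
    (e : G ≃+ ((∀ i : Fin r₁, ZMod (2 ^ α i)) × (Fin r₂ → ZMod 2) × K)) :
    (twoTorsion G).card = 2 ^ (r₁ + r₂) := by
  rw [← natCard_add_self_eq_zero_prod (r₂ := r₂) hK hα, ← Fintype.card_coe, ← Nat.card_eq_fintype_card]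
  refine Nat.card_congr (e.toEquiv.subtypeEquiv fun x => ?_)
  rw [mem_twoTorsion, AddEquiv.toEquiv_eq_coe, AddEquiv.coe_toEquiv, ← map_add,
    EmbeddingLike.map_eq_zero_iff]

omit [Fintype G] [DecidableEq G] in
/-- The homomorphisms `coordHom` transported to `G`, split according to whether they vanish on the
2-torsion. -/
theorem exists_homs [Finite G] (hα : ∀ i, 2 ≤ α i)
    (e : G ≃+ ((∀ i : Fin r₁, ZMod (2 ^ α i)) × (Fin r₂ → ZMod 2) × K)) :
    ∃ 𝒳₀ 𝒳₁ : Finset (G →+ ZMod 2), 𝒳₀.card = 2 ^ r₁ - 1 ∧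
      𝒳₁.card = 2 ^ r₁ * (2 ^ r₂ - 1) ∧
      (∀ χ ∈ 𝒳₀, χ ≠ 0 ∧ ∀ x : G, x + x = 0 → χ x = 0) ∧
      ∀ χ ∈ 𝒳₁, ∃ x : G, x + x = 0 ∧ χ x = 1 := by
  classical
  let Φ : (Fin r₁ → ZMod 2) × (Fin r₂ → ZMod 2) → (G →+ ZMod 2) :=
    fun w => (coordHom K hα w).comp e.toAddMonoidHom
  have hΦ : Function.Injective Φ := by
    intro w w' h
    refine coordHom_injective (K := K) hα (DFunLike.ext _ _ fun x => ?_)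
    simpa [Φ] using DFunLike.congr_fun h (e.symm x)
  refine ⟨(({0}ᶜ : Finset (Fin r₁ → ZMod 2)) ×ˢ {0}).image Φ,
    ((Finset.univ : Finset (Fin r₁ → ZMod 2)) ×ˢ {0}ᶜ).image Φ, ?_, ?_, ?_, ?_⟩
  · rw [Finset.card_image_of_injective _ hΦ, Finset.card_product, Finset.card_compl]
    simp [ZMod.card]
  · rw [Finset.card_image_of_injective _ hΦ, Finset.card_product, Finset.card_compl]
    simp [ZMod.card]
  · intro χ hχ
    simp only [Finset.mem_image, Finset.mem_product, Finset.mem_compl, Finset.mem_singleton,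
      Prod.exists] at hχ
    obtain ⟨u, v, ⟨hu, rfl⟩, rfl⟩ := hχ
    refine ⟨fun h => ?_, fun x hx => ?_⟩
    · have h0 : Φ (0, 0) = 0 := by
        ext x
        simp [Φ, coordHom_apply]
      exact hu (congrArg Prod.fst (hΦ (h.trans h0.symm)))
    · exact coordHom_eq_zero_of_add_self hα u (x := e x) (by rw [← map_add, hx, map_zero])
  · intro χ hχ
    simp only [Finset.mem_image, Finset.mem_product, Finset.mem_compl, Finset.mem_singleton,
      Prod.exists] at hχ
    obtain ⟨u, v, ⟨-, hv⟩, rfl⟩ := hχ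
    obtain ⟨j, hj⟩ := Function.ne_iff.1 hv
    have two : ∀ a : ZMod 2, a ≠ 0 → a = 1 := by decide
    refine ⟨e.symm (0, Pi.single j 1, 0), ?_, ?_⟩
    · rw [← map_add, EmbeddingLike.map_eq_zero_iff]
      refine Prod.ext (add_zero 0) (Prod.ext ?_ (add_zero 0))
      exact funext fun _ => CharTwo.add_self_eq_zero _
    · simpa [Φ, coordHom_single_right] using two _ hj

end Main

theorem mainTheorem3 :
    ∃ C : ℕ, 0 < C ∧
      ∀ η : ℝ, 0 < η →
        ∃ n₀ : ℕ, 0 < n₀ ∧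
          ∀ n : ℕ, Even n → n₀ ≤ n →
            ∀ (G : Type u) [AddCommGroup G] [Finite G], Nat.card G = n →
              ∀ (K : Type v) [AddCommGroup K] [Finite K], Odd (Nat.card K) →
                ∀ (r r₁ r₂ : ℕ) (α : Fin r₁ → ℕ),
                  r = r₁ + r₂ → 0 < r → Antitone α → (∀ i, 2 ≤ α i) →
                  Nonempty (G ≃+ ((∀ i : Fin r₁, ZMod (2 ^ α i)) × (Fin r₂ → ZMod 2) × K)) →
                  (C : ℝ) ≤ (n : ℝ) / 2 ^ r →
                    ((2 : ℝ) ^ (2 * (r : ℝ) - 1) + (2 : ℝ) ^ ((r : ℝ) + (r₁ : ℝ) - 1)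
                          - (2 : ℝ) ^ (r + 1) + (2 : ℝ) ^ r₁) * (2 : ℝ) ^ ((n : ℝ) / 4)
                        + ((2 : ℝ) ^ r - (2 : ℝ) ^ r₁ - η)
                          * (2 : ℝ) ^ ((n : ℝ) / 4 - (2 : ℝ) ^ ((r : ℝ) - 2))
                      ≤ (fStarMax G : ℝ) := by
  -- With `C = 704` one has `2 ^ (r - 2) ≤ n / 2816`, which the exponential saving in the error term
  -- absorbs.
  refine ⟨704, by norm_num, fun η hη => ?_⟩
  obtain ⟨n₀, hn₀, herr⟩ := exists_forall_error_le hη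
  refine ⟨n₀, hn₀, ?_⟩
  intro n _ hn G _ _ hG K _ _ hK r r₁ r₂ α hr _ _ hα ⟨e⟩ hC
  classical
  have := Fintype.ofFinite G
  have hcardG : Fintype.card G = n := by rw [← Nat.card_eq_fintype_card, hG]
  have htt : (twoTorsion G).card = 2 ^ r := by rw [hr, card_twoTorsion hK hα e]
  have htt' : ((twoTorsion G).card : ℝ) = 2 ^ r := by rw [htt]; push_cast; rfl
  rw [le_div_iff₀ (by positivity)] at hC
  have hCn : 704 * 2 ^ r ≤ n := by exact_mod_cast hC
  obtain ⟨𝒳₀, 𝒳₁, hc₀, hc₁, h₀, h₁⟩ := exists_homs hα e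
  have hp₁ : 1 ≤ 2 ^ r₁ := Nat.one_le_two_pow
  have hp₂ : 1 ≤ 2 ^ r₂ := Nat.one_le_two_pow
  have hpr : 2 ^ r = 2 ^ r₁ * 2 ^ r₂ := by rw [hr, pow_add]
  have hc : 𝒳₀.card + 𝒳₁.card ≤ Fintype.card G := by
    rw [hc₀, hc₁, hcardG, Nat.mul_sub, ← hpr]
    have := Nat.le_mul_of_pos_right (2 ^ r₁) hp₂
    omega
  have hmain := le_fStarMax (by rw [htt, hcardG]; omega) 𝒳₀ 𝒳₁
    (fun χ hχ => ⟨(h₀ χ hχ).1, fun x hx => (h₀ χ hχ).2 x (mem_twoTorsion.1 hx)⟩)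
    (fun χ hχ => by
      obtain ⟨x, hx, h⟩ := h₁ χ hχ
      exact ⟨x, mem_twoTorsion.2 hx, h⟩) hc
  have hc₀' : (𝒳₀.card : ℝ) = 2 ^ r₁ - 1 := by rw [hc₀]; push_cast [hp₁]; ring
  have hc₁' : (𝒳₁.card : ℝ) = 2 ^ r - 2 ^ r₁ := by
    rw [hc₁, hr, pow_add]; push_cast [hp₂]; ring
  rw [hcardG, htt', hc₀', hc₁'] at hmain
  have e1 : (2 : ℝ) ^ (2 * (r : ℝ) - 1) = 2 ^ r * 2 ^ r / 2 := by
    rw [Real.rpow_sub (by norm_num), Real.rpow_one, two_mul, Real.rpow_add (by norm_num),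
      Real.rpow_natCast]
  have e2 : (2 : ℝ) ^ ((r : ℝ) + (r₁ : ℝ) - 1) = 2 ^ r * 2 ^ r₁ / 2 := by
    rw [Real.rpow_sub (by norm_num), Real.rpow_one, Real.rpow_add (by norm_num),
      Real.rpow_natCast, Real.rpow_natCast]
  have e3 : (2 : ℝ) ^ ((r : ℝ) - 2) = 2 ^ r / 4 := by
    rw [Real.rpow_sub (by norm_num), Real.rpow_natCast]
    norm_num
  rw [e1, e2, e3, pow_succ]
  set N := (2 : ℝ) ^ ((n : ℝ) / 4) with hN
  have herrn : (n : ℝ) ^ 3 * (15 / 16 : ℝ) ^ ((n : ℝ) / 64) * N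
      ≤ η * (2 : ℝ) ^ ((n : ℝ) / 4 - 2 ^ r / 4) := by
    have h1 : N ≤ (2 : ℝ) ^ ((n : ℝ) / 2816) * (2 : ℝ) ^ ((n : ℝ) / 4 - 2 ^ r / 4) := by
      rw [hN, ← Real.rpow_add (by norm_num)]
      refine Real.rpow_le_rpow_of_exponent_le (by norm_num) ?_
      push_cast at hC
      linarith
    calc (n : ℝ) ^ 3 * (15 / 16 : ℝ) ^ ((n : ℝ) / 64) * N
        ≤ (n : ℝ) ^ 3 * (15 / 16 : ℝ) ^ ((n : ℝ) / 64)
          * ((2 : ℝ) ^ ((n : ℝ) / 2816) * (2 : ℝ) ^ ((n : ℝ) / 4 - 2 ^ r / 4)) :=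
          mul_le_mul_of_nonneg_left h1 (by positivity)
      _ = ((n : ℝ) ^ 3 * (15 / 16 : ℝ) ^ ((n : ℝ) / 64) * (2 : ℝ) ^ ((n : ℝ) / 2816))
          * (2 : ℝ) ^ ((n : ℝ) / 4 - 2 ^ r / 4) := by ring
      _ ≤ _ := mul_le_mul_of_nonneg_right (herr n hn) (by positivity)
  refine (le_of_eq ?_).trans ((sub_le_sub_left herrn _).trans hmain)
  ring
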